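/- All topological spaces are non-empty. Let $\mathcal M(E)$ be the modal language whose formulas are built from countably infinitely many propositional letters by $\top,\wedge,\neg$, $\Box$ and the global modality $E$. For a space $X$ and a valuation $\nu$ sending letters to subsets of $X$, $\Box\phi$ is true at $w$ iff $\phi$ is true throughout some open neighbourhood of $w$, and $E\phi$ is true at $w$ iff $\phi$ is true at some point of $X$; the other clauses are as usual. $\phi$ is valid in $X$ if it is true at all points under all valuations. A class $\mathsf K$ of spaces is definable in $\mathcal M(E)$ if there is a set $\Gamma$ of $\mathcal M(E)$-formulas such that, for every space $X$, $X\in\mathsf K$ iff all formulas of $\Gamma$ are valid in $X$. Let $\mathcal L^2$ be the two-sorted first-order language with point variables $x,y,\dots$ (ranging over points) and open variables $U,V,\dots$ (ranging over open sets), with atomic formulas $\top$, $x=y$, $U=V$, $x\,\varepsilon\,U$ (membership) and, for models with a valuation, unary predicates $P_p(x)$ for the propositional letters, closed under $\neg,\wedge$, $\exists x$, $\exists U$; $\forall$ and $\to$ are abbreviations, with $\phi\to\psi:=\neg(\phi\wedge\neg\psi)$ and $\forall:=\neg\exists\neg$. A formula is positive (negative) in $U$ if all free occurrences of $U$ are under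 an even (odd) number of negation signs, where $U=V$ is read as $\forall x(x\,\varepsilon\,U\leftrightarrow x\,\varepsilon\,V)$, so that in it $U$ and $V$ occur both positively and negatively. $\mathcal L_t$ is the least set of $\mathcal L^2$-formulas that contains the atomic formulas, is closed under $\neg$, $\wedge$ and quantification over point variables, and contains $\forall U(x\,\varepsilon\,U\to\alpha)$ whenever it contains $\alpha$ and $\alpha$ is positive in $U$, and $\exists U(x\,\varepsilon\,U\wedge\alpha)$ whenever it contains $\alpha$ and $\alpha$ is negative in $U$. A class $\mathsf K$ of spaces is $\mathcal L_t$-definable if there is a set $\Gamma$ of $\mathcal L_t$-sentences without unary predicates such that, for every space $X$, $X\in\mathsf K$ iff all sentences of $\Gamma$ are true in $X$. A filter $\mathcal F$ over $X$ is open if the interior of $A$ is in $\mathcal F$ for every $A\in\mathcal F$. The Alexandroff extension $X^*$ of $X$ is the set of all ultrafilters over $X$ with the topology generated by the sets $\{\mathfrak u\mid\mathcal F\subseteq\mathfrak u\}$, $\mathcal F$ an open filter over $X$. **Theorem 5.1.** Let $\mathsf K$ be an $\mathcal L_t$-definable class of topological spaces. Then $\mathsf K$ is definable in $\mathcal M(E)$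 if and only if both of the following hold: (a) $\mathsf K$ is closed under interior images: if $X\in\mathsf K$ and $f:X\to Y$ is a surjective, continuous and open map of spaces, then $Y\in\mathsf K$; and (b) $\mathsf K$ reflects Alexandroff extensions: if $X^*\in\mathsf K$, then $X\in\mathsf K$. -/

import Mathlib

universe u v w

/-- A class of (non-empty) topological spaces. -/
abbrev SpaceClass : Type (u + 1) :=
  ∀ (X : Type u) [TopologicalSpace X] [Nonempty X], Prop

/-! ### The modal language with the global modality -/

/-- Formulas of the basic modal language extended with the global modality `E`,
over a type `P` of propositional letters. -/
inductive MEFormula (P : Type v) : Type v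
  | top : MEFormula P
  | letter : P → MEFormula P
  | and : MEFormula P → MEFormula P → MEFormula P
  | neg : MEFormula P → MEFormula P
  | box : MEFormula P → MEFormula P
  | glob : MEFormula P → MEFormula P

namespace MEFormula

/-- Truth of a formula at a point of the topological model `(X, ν)`. -/
def Sat {P : Type v} {X : Type w} [TopologicalSpace X] (ν : P → Set X) :
    MEFormula P → X → Prop
  | top, _ => True
  | letter p, x => x ∈ ν p
  | and φ ψ, x => Sat ν φ x ∧ Sat ν ψ x
  | neg φ, x => ¬ Sat ν φ x
  | box φ, x => ∃ O : Set X, IsOpen O ∧ x ∈ O ∧ ∀ y ∈ O, Sat ν φ y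
  | glob φ, _ => ∃ y : X, Sat ν φ y

/-- `φ` is valid in the space `X`: true at every point under every valuation. -/
def Valid {P : Type v} (φ : MEFormula P) (X : Type w) [TopologicalSpace X] : Prop :=
  ∀ (ν : P → Set X) (x : X), φ.Sat ν x

end MEFormula

/-- `K` is defined by some set of formulas of the modal language with the global modality
over a countably infinite set of propositional letters. -/
def GlobalModalDefinable (K : SpaceClass.{u}) : Prop :=
  ∃ Γ : Set (MEFormula ℕ), ∀ (X : Type u) [TopologicalSpace X] [Nonempty X],
    K X ↔ ∀ φ ∈ Γ, φ.Valid X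

/-! ### The two-sorted language `L²` and its fragment `L_t` -/

/-- Formulas of the two-sorted language `L²`, with one unary predicate symbol for each element
of `P`. Point variables and open variables are both indexed by `ℕ`. -/
inductive L2Formula (P : Type v) : Type v
  | top : L2Formula P
  | eqPt : ℕ → ℕ → L2Formula P
  | eqOpen : ℕ → ℕ → L2Formula P
  | pred : P → ℕ → L2Formula P
  | mem : ℕ → ℕ → L2Formula P
  | neg : L2Formula P → L2Formula P
  | and : L2Formula P → L2Formula P → L2Formula P
  | exPt : ℕ → L2Formula P → L2Formula P
  | exOpen : ℕ → L2Formula P → L2Formula P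

namespace L2Formula

variable {P : Type v}

/-- `φ → ψ`, as the abbreviation `¬(φ ∧ ¬ψ)`. -/
def imp (φ ψ : L2Formula P) : L2Formula P := neg (and φ (neg ψ))

/-- `∀ U. φ`, as the abbreviation `¬∃ U. ¬φ`. -/
def allOpen (U : ℕ) (φ : L2Formula P) : L2Formula P := neg (exOpen U (neg φ))

/-- Satisfaction in the structure `(X, σ, ν)` in which point variables range over `X` and open
variables range over the members of `σ`, under the assignments `g` and `G`. -/
def Sat {X : Type w} (σ : Set (Set X)) (ν : P → Set X) :
    L2Formula P → (ℕ → X) → (ℕ → Set X) → Prop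
  | top, _, _ => True
  | eqPt x y, g, _ => g x = g y
  | eqOpen U V, _, G => G U = G V
  | pred p x, g, _ => g x ∈ ν p
  | mem x U, g, G => g x ∈ G U
  | neg φ, g, G => ¬ Sat σ ν φ g G
  | and φ ψ, g, G => Sat σ ν φ g G ∧ Sat σ ν ψ g G
  | exPt x φ, g, G => ∃ a : X, Sat σ ν φ (Function.update g x a) G
  | exOpen U φ, g, G => ∃ O ∈ σ, Sat σ ν φ g (Function.update G U O)

/-- The free point variables of a formula. -/
def freePt : L2Formula P → Set ℕ
  | top => ∅
  | eqPt x y => {x, y}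
  | eqOpen _ _ => ∅
  | pred _ x => {x}
  | mem x _ => {x}
  | neg φ => freePt φ
  | and φ ψ => freePt φ ∪ freePt ψ
  | exPt x φ => freePt φ \ {x}
  | exOpen _ φ => freePt φ

/-- The free open variables of a formula. -/
def freeOpen : L2Formula P → Set ℕ
  | top => ∅
  | eqPt _ _ => ∅
  | eqOpen U V => {U, V}
  | pred _ _ => ∅
  | mem _ U => {U}
  | neg φ => freeOpen φ
  | and φ ψ => freeOpen φ ∪ freeOpen ψ
  | exPt _ φ => freeOpen φ
  | exOpen U φ => freeOpen φ \ {U}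

/-- A sentence is a formula without free variables. -/
def IsSentence (φ : L2Formula P) : Prop := φ.freePt = ∅ ∧ φ.freeOpen = ∅

/-- `HasPolarity U b φ`: all free occurrences of the open variable `U` in `φ` are under an even
(`b = true`) or odd (`b = false`) number of negation signs. An equation `U = V` between open
variables is understood as `∀ x. (x ε U ↔ x ε V)`, so in it both variables occur both
positively and negatively. -/
def HasPolarity (U : ℕ) : Bool → L2Formula P → Prop
  | _, top => True
  | _, eqPt _ _ => True
  | _, eqOpen V W => V ≠ U ∧ W ≠ U
  | _, pred _ _ => True
  | b, mem _ V => V = U → b = true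
  | b, neg φ => HasPolarity U (!b) φ
  | b, and φ ψ => HasPolarity U b φ ∧ HasPolarity U b ψ
  | b, exPt _ φ => HasPolarity U b φ
  | b, exOpen V φ => V = U ∨ HasPolarity U b φ

/-- `φ` is positive in the open variable `U`. -/
def PositiveIn (φ : L2Formula P) (U : ℕ) : Prop := HasPolarity U true φ

/-- `φ` is negative in the open variable `U`. -/
def NegativeIn (φ : L2Formula P) (U : ℕ) : Prop := HasPolarity U false φ

/-- The formulas of the language `L_t`. -/
inductive IsLt : L2Formula P → Prop
  | top : IsLt top
  | eqPt (x y : ℕ) : IsLt (eqPt x y)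
  | eqOpen (U V : ℕ) : IsLt (eqOpen U V)
  | pred (p : P) (x : ℕ) : IsLt (pred p x)
  | mem (x U : ℕ) : IsLt (mem x U)
  | neg {φ : L2Formula P} : IsLt φ → IsLt (neg φ)
  | and {φ ψ : L2Formula P} : IsLt φ → IsLt ψ → IsLt (and φ ψ)
  | exPt (x : ℕ) {φ : L2Formula P} : IsLt φ → IsLt (exPt x φ)
  | allOpen (x U : ℕ) {φ : L2Formula P} : IsLt φ → PositiveIn φ U →
      IsLt (allOpen U (imp (mem x U) φ))
  | exOpen (x U : ℕ) {φ : L2Formula P} : IsLt φ → NegativeIn φ U →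
      IsLt (exOpen U (and (mem x U) φ))

/-- A space, as opposed to a topological model, carries no valuation: it interprets the formulas
over the empty set of unary predicate symbols, with the open variables ranging over all open
sets. `φ.HoldsIn X` means that `φ` is true in `X` under every assignment; for a sentence the
assignment is irrelevant. -/
def HoldsIn (φ : L2Formula Empty) (X : Type w) [TopologicalSpace X] : Prop :=
  ∀ (g : ℕ → X) (G : ℕ → Set X), (∀ U, IsOpen (G U)) →
    φ.Sat {O : Set X | IsOpen O} (fun p => p.elim) g G

end L2Formula

/-- `K` is defined by some set of `L_t`-sentences. -/
def LtDefinable (K : SpaceClass.{u}) : Prop :=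
  ∃ Γ : Set (L2Formula Empty), (∀ φ ∈ Γ, φ.IsLt ∧ φ.IsSentence) ∧
    ∀ (X : Type u) [TopologicalSpace X] [Nonempty X], K X ↔ ∀ φ ∈ Γ, φ.HoldsIn X

/-! ### Interior images and Alexandroff extensions -/

/-- `K` is closed under images of surjective interior (continuous and open) maps. -/
def ClosedUnderInteriorImages (K : SpaceClass.{u}) : Prop :=
  ∀ (X Y : Type u) [TopologicalSpace X] [Nonempty X] [TopologicalSpace Y] [Nonempty Y]
    (f : X → Y), Continuous f → IsOpenMap f → Function.Surjective f → K X → K Y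

/-- The underlying set of the Alexandroff extension of `X`: the ultrafilters over `X`. (A separate
name, since the topology on `Ultrafilter X` in Mathlib is a different one.) -/
def AlexandroffExtension (X : Type u) : Type u := Ultrafilter X

/-- A filter `F` over a space is open if `interior A ∈ F` for all `A ∈ F`. -/
def Filter.IsOpenFilter {X : Type u} [TopologicalSpace X] (F : Filter X) : Prop :=
  ∀ A ∈ F, interior A ∈ F

/-- The topology generated by the sets of all ultrafilters that extend `F`, for `F` an open
filter over `X`. -/
instance AlexandroffExtension.instTopologicalSpace (X : Type u) [TopologicalSpace X] :
    TopologicalSpace (AlexandroffExtension X) :=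
  TopologicalSpace.generateFrom
    {S | ∃ F : Filter X, F.IsOpenFilter ∧ S = {𝔲 : Ultrafilter X | ∀ A ∈ F, A ∈ 𝔲}}

instance AlexandroffExtension.instNonempty (X : Type u) [Nonempty X] :
    Nonempty (AlexandroffExtension X) :=
  inferInstanceAs (Nonempty (Ultrafilter X))

/-- `K` reflects Alexandroff extensions: a space belongs to `K` whenever its Alexandroff
extension does. -/
def ReflectsAlexandroffExtensions (K : SpaceClass.{u}) : Prop :=
  ∀ (X : Type u) [TopologicalSpace X] [Nonempty X], K (AlexandroffExtension X) → K X

/-!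
Validity of modal formulas with the global modality is preserved by interior images, and it is
reflected by Alexandroff extensions because truth of `φ` at an ultrafilter `𝔲`, under the extended
valuation, means that the truth set of `φ` belongs to `𝔲` (`AlexandroffExtension.sat_iff`). This
gives one direction.

Conversely, let the `L_t`-definable class `K` have both closure properties and let `X` validate
every modal formula that is valid in `K`. Take a letter for every subset of `X`. Each finite set
of formulas that are globally true in `X` is globally true in some model on a member of `K`
(`MEFormula.exists_model`). From these models a space in `K` is built that maps onto the
Alexandroff extension of `X` by an interior map; the closure properties then give `K X`.

The space is a saturated elementary extension of an ultraproduct of the models. Saturation is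
needed only for conditions indexed by the subsets of `X`, with finitely many parameters, so the
union of an `ω`-chain of ultrapowers by one ultrafilter on the finite sets of conditions suffices.
This union is given directly (`LimitUltraproduct.Point`): its points are functions of an infinite
sequence `s` of finite sets that depend on finitely many terms of `s`, modulo an ultrafilter
`LimitUltraproduct.limit` on the sequences that is the limit of iterated products. A function that
depends on the first `n` terms parametrizes conditions, and a solution `z` is chosen such that
`z s` meets the conditions in `s n` (`LimitUltraproduct.exists_forall_eventually_mem`). Łoś's
theorem (`LimitUltraproduct.sat_iff`) speaks of the internal open sets, which only form a basis of
a topology; `L_t` cannot distinguish a topology from a basis (`L2Formula.IsLt.sat_basis_iff`), so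
the space belongs to `K`.

The map sends a point to the ultrafilter of all `A ⊆ X` whose letter is true at the point.
Saturation for points makes it surjective and open, saturation for open sets makes it continuous
(`RepresentsAlong.surjective_toExtension`, `RepresentsAlong.isOpenMap_toExtension`,
`RepresentsAlong.continuous_toExtension`).
-/

/-! ### Modal formulas -/

namespace MEFormula

section

variable {P : Type v} {Q : Type*} {X : Type w} [TopologicalSpace X]

theorem setOf_sat_box (ν : P → Set X) (φ : MEFormula P) :
    {x | Sat ν (box φ) x} = interior {x | Sat ν φ x} := by
  ext x
  simp only [Sat, Set.mem_ofPred_eq, mem_interior]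
  constructor
  · rintro ⟨O, hO, hx, h⟩
    exact ⟨O, h, hO, hx⟩
  · rintro ⟨O, h, hO, hx⟩
    exact ⟨O, hO, hx, h⟩

theorem sat_box_iff (ν : P → Set X) (φ : MEFormula P) (x : X) :
    Sat ν (box φ) x ↔ x ∈ interior {x | Sat ν φ x} := by
  rw [← setOf_sat_box]; rfl

/-- The propositional letters that occur in a formula. -/
def letters : MEFormula P → Set P
  | top => ∅
  | letter p => {p}
  | and φ ψ => letters φ ∪ letters ψ
  | neg φ => letters φ
  | box φ => letters φ
  | glob φ => letters φ

theorem countable_letters (φ : MEFormula P) : φ.letters.Countable := by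
  induction φ with
  | top => exact Set.countable_empty
  | letter p => exact Set.countable_singleton p
  | and φ ψ h₁ h₂ => exact h₁.union h₂
  | neg φ h => exact h
  | box φ h => exact h
  | glob φ h => exact h

theorem sat_congr (φ : MEFormula P) {ν ν' : P → Set X} (h : ∀ p ∈ φ.letters, ν p = ν' p)
    (x : X) : Sat ν φ x ↔ Sat ν' φ x := by
  induction φ generalizing x with
  | top => exact Iff.rfl
  | letter p => simp only [Sat, h p rfl]
  | and φ ψ h₁ h₂ =>
    exact and_congr (h₁ (fun p hp => h p (Or.inl hp)) x) (h₂ (fun p hp => h p (Or.inr hp)) x)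
  | neg φ ih => exact not_congr (ih h x)
  | box φ ih => simp only [Sat, ih h]
  | glob φ ih => simp only [Sat, ih h]

/-- Renaming of the propositional letters. -/
def map (f : P → Q) : MEFormula P → MEFormula Q
  | top => top
  | letter p => letter (f p)
  | and φ ψ => and (map f φ) (map f ψ)
  | neg φ => neg (map f φ)
  | box φ => box (map f φ)
  | glob φ => glob (map f φ)

theorem sat_map (f : P → Q) (φ : MEFormula P) (ν : Q → Set X) (x : X) :
    Sat ν (map f φ) x ↔ Sat (ν ∘ f) φ x := by
  induction φ generalizing x with
  | top => exact Iff.rfl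
  | letter p => exact Iff.rfl
  | and φ ψ h₁ h₂ => exact and_congr (h₁ x) (h₂ x)
  | neg φ ih => exact not_congr (ih x)
  | box φ ih => simp only [map, Sat, ih]
  | glob φ ih => simp only [map, Sat, ih]

/-- The conjunction of a list of formulas. -/
def conj : List (MEFormula P) → MEFormula P
  | [] => top
  | φ :: l => and φ (conj l)

theorem sat_conj (l : List (MEFormula P)) (ν : P → Set X) (x : X) :
    Sat ν (conj l) x ↔ ∀ φ ∈ l, Sat ν φ x := by
  induction l with
  | nil => simp [conj, Sat]
  | cons φ l ih => simp [conj, Sat, ih]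

theorem sat_comp_preimage {Y : Type*} [TopologicalSpace Y] {f : X → Y} (hc : Continuous f)
    (ho : IsOpenMap f) (hs : Function.Surjective f) (ν : P → Set Y) (φ : MEFormula P) (x : X) :
    Sat (fun p => f ⁻¹' ν p) φ x ↔ Sat ν φ (f x) := by
  induction φ generalizing x with
  | top => exact Iff.rfl
  | letter p => exact Iff.rfl
  | and φ ψ h₁ h₂ => exact and_congr (h₁ x) (h₂ x)
  | neg φ ih => exact not_congr (ih x)
  | box φ ih =>
    rw [sat_box_iff, sat_box_iff, ← Set.mem_preimage, ho.preimage_interior_eq_interior_preimage hc]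
    simp only [ih, Set.preimage_ofPred_eq]
  | glob φ ih => simp only [Sat, ih, hs.exists]

theorem Valid.of_interior_image {Y : Type*} [TopologicalSpace Y] {f : X → Y} (hc : Continuous f)
    (ho : IsOpenMap f) (hs : Function.Surjective f) {φ : MEFormula P} (h : φ.Valid X) :
    φ.Valid Y := by
  intro ν y
  obtain ⟨x, rfl⟩ := hs y
  exact (sat_comp_preimage hc ho hs ν φ x).1 (h _ x)

end

/-- Since a formula has only countably many letters, validity of formulas over `ℕ` determines
validity of formulas over any set of letters. -/
theorem valid_of_forall_nat {P : Type v} [Nonempty P] {K : SpaceClass.{u}} {X : Type u}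
    [TopologicalSpace X]
    (hX : ∀ φ : MEFormula ℕ,
      (∀ (Y : Type u) [TopologicalSpace Y] [Nonempty Y], K Y → φ.Valid Y) → φ.Valid X)
    (φ : MEFormula P)
    (hφ : ∀ (Y : Type u) [TopologicalSpace Y] [Nonempty Y], K Y → φ.Valid Y) : φ.Valid X := by
  intro ν x
  obtain ⟨e, he⟩ := Set.countable_iff_exists_injOn.1 φ.countable_letters
  have h := hX (φ.map e) (fun Y _ _ hY ν y => (sat_map e φ ν y).2 (hφ Y hY _ y))
    (fun n => ν (Function.invFunOn e φ.letters n)) x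
  rw [sat_map] at h
  refine (sat_congr φ (fun p hp => ?_) x).1 h
  simp only [Function.comp_apply, he.leftInvOn_invFunOn hp]

/-- If `X` validates the modal logic of `K`, then every finite set of formulas that are globally
true in some model on `X` is globally true in some model on a member of `K`. -/
theorem exists_model {P : Type v} [Nonempty P] {K : SpaceClass.{u}} {X : Type u}
    [TopologicalSpace X] [Nonempty X]
    (hX : ∀ φ : MEFormula ℕ,
      (∀ (Y : Type u) [TopologicalSpace Y] [Nonempty Y], K Y → φ.Valid Y) → φ.Valid X)
    (ν : P → Set X) (δ : Finset (MEFormula P)) (hδ : ∀ φ ∈ δ, ∀ x, Sat ν φ x) :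
    ∃ (Y : Type u) (_ : TopologicalSpace Y) (_ : Nonempty Y) (ν' : P → Set Y),
      K Y ∧ ∀ φ ∈ δ, ∀ y, Sat ν' φ y := by
  by_contra! hcon
  obtain ⟨y, hy⟩ := valid_of_forall_nat hX (glob (neg (conj δ.toList)))
    (fun Y _ _ hY ν' _ => by
      obtain ⟨φ, hφ, y, hy⟩ := hcon Y _ _ ν' hY
      refine ⟨y, fun h => hy ?_⟩
      exact (sat_conj _ _ _).1 h φ (Finset.mem_toList.2 hφ))
    ν (Classical.arbitrary X)
  exact hy ((sat_conj _ _ _).2 fun φ hφ => hδ φ (Finset.mem_toList.1 hφ) y)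

end MEFormula

/-! ### Alexandroff extensions -/

namespace AlexandroffExtension

variable {X : Type u} [TopologicalSpace X]

/-- The open filter of all sets whose interior belongs to the ultrafilter `𝔲`. -/
def openCore (𝔲 : Ultrafilter X) : Filter X where
  sets := {A | interior A ∈ 𝔲}
  univ_sets := by
    rw [Set.mem_ofPred_eq, interior_univ]
    exact Filter.univ_mem
  sets_of_superset := fun hA hAB => Filter.mem_of_superset hA (interior_mono hAB)
  inter_sets := fun hA hB => by
    rw [Set.mem_ofPred_eq, interior_inter]
    exact Filter.inter_mem hA hB

theorem mem_openCore {𝔲 : Ultrafilter X} {A : Set X} : A ∈ openCore 𝔲 ↔ interior A ∈ 𝔲 :=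
  Iff.rfl

theorem isOpenFilter_openCore (𝔲 : Ultrafilter X) : (openCore 𝔲).IsOpenFilter := by
  intro A hA
  rwa [mem_openCore, interior_interior]

/-- The smallest neighbourhood of a point of the Alexandroff extension. -/
def minNhd (𝔲 : Ultrafilter X) : Set (AlexandroffExtension X) :=
  {𝔳 : Ultrafilter X | ∀ A ∈ openCore 𝔲, A ∈ 𝔳}

theorem isOpen_minNhd (𝔲 : Ultrafilter X) : IsOpen (minNhd 𝔲) :=
  TopologicalSpace.isOpen_generateFrom_of_mem ⟨_, isOpenFilter_openCore 𝔲, rfl⟩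

theorem self_mem_minNhd (𝔲 : Ultrafilter X) : (show AlexandroffExtension X from 𝔲) ∈ minNhd 𝔲 :=
  fun _ hA => Filter.mem_of_superset (mem_openCore.1 hA) interior_subset

theorem minNhd_subset {O : Set (AlexandroffExtension X)} (hO : IsOpen O) {𝔲 : Ultrafilter X}
    (h : (show AlexandroffExtension X from 𝔲) ∈ O) : minNhd 𝔲 ⊆ O := by
  induction hO with
  | basic S hS =>
    obtain ⟨F, hF, rfl⟩ := hS
    exact fun 𝔳 h𝔳 A hA => h𝔳 A (mem_openCore.2 (h _ (hF A hA)))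
  | univ => exact Set.subset_univ _
  | inter S T _ _ hS hT => exact Set.subset_inter (hS h.1) (hT h.2)
  | sUnion 𝒮 _ ih =>
    obtain ⟨S, hS, hu⟩ := h
    exact (ih S hS hu).trans (Set.subset_sUnion_of_mem hS)

/-- Truth at an ultrafilter, under the valuation that extends `ν`, is membership of the truth
set. -/
theorem sat_iff {P : Type v} (ν : P → Set X) (φ : MEFormula P) (𝔲 : Ultrafilter X) :
    φ.Sat (X := AlexandroffExtension X) (fun p => {𝔳 : Ultrafilter X | ν p ∈ 𝔳}) 𝔲 ↔
      {x | φ.Sat ν x} ∈ 𝔲 := by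
  induction φ generalizing 𝔲 with
  | top =>
    exact ⟨fun _ => Filter.mem_of_superset Filter.univ_mem fun _ _ => trivial, fun _ => trivial⟩
  | letter p => exact Iff.rfl
  | and φ ψ h₁ h₂ =>
    exact (and_congr (h₁ 𝔲) (h₂ 𝔲)).trans Filter.inter_mem_iff.symm
  | neg φ ih =>
    exact (not_congr (ih 𝔲)).trans Ultrafilter.compl_mem_iff_notMem.symm
  | box φ ih =>
    rw [MEFormula.setOf_sat_box]
    constructor
    · rintro ⟨O, hO, hu, h⟩
      by_contra hcon
      -- An ultrafilter in the smallest neighbourhood of `𝔲` that omits the truth set of `φ`.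
      have hne : (openCore 𝔲 ⊓ Filter.principal {x | φ.Sat ν x}ᶜ).NeBot := by
        rw [Filter.inf_principal_neBot_iff]
        intro A hA
        by_contra hempty
        refine hcon (Filter.mem_of_superset (mem_openCore.1 hA) (interior_mono fun x hx => ?_))
        by_contra hx'
        exact hempty ⟨x, hx, hx'⟩
      obtain ⟨𝔳, h𝔳⟩ := Ultrafilter.exists_le (openCore 𝔲 ⊓ Filter.principal {x | φ.Sat ν x}ᶜ)
      have h1 : (show AlexandroffExtension X from 𝔳) ∈ O :=
        minNhd_subset hO hu fun A hA => h𝔳 (Filter.mem_inf_of_left hA)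
      have h2 := (ih 𝔳).1 (h 𝔳 h1)
      have h3 : {x | φ.Sat ν x}ᶜ ∈ 𝔳 :=
        h𝔳 (Filter.mem_inf_of_right (Filter.mem_principal_self _))
      exact Ultrafilter.compl_mem_iff_notMem.1 h3 h2
    · intro h
      exact ⟨minNhd 𝔲, isOpen_minNhd 𝔲, self_mem_minNhd 𝔲, fun 𝔳 h𝔳 => (ih 𝔳).2 (h𝔳 _ h)⟩
  | glob φ ih =>
    constructor
    · rintro ⟨𝔳, h𝔳⟩
      obtain ⟨y, hy⟩ := Ultrafilter.nonempty_of_mem ((ih 𝔳).1 h𝔳)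
      exact Filter.mem_of_superset Filter.univ_mem fun x _ => ⟨y, hy⟩
    · intro h
      obtain ⟨x, y, hy⟩ := Ultrafilter.nonempty_of_mem h
      exact ⟨(pure y : Ultrafilter X), (ih _).2 (Ultrafilter.mem_pure.2 hy)⟩

theorem valid_of_valid {P : Type v} {φ : MEFormula P} (h : φ.Valid (AlexandroffExtension X)) :
    φ.Valid X := fun ν x =>
  Ultrafilter.mem_pure.1 ((sat_iff ν φ (pure x)).1 (h _ _))

end AlexandroffExtension

/-! ### The language `L_t` and bases of a topology -/

namespace L2Formula

variable {P : Type v} {X : Type w}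

theorem sat_congr (φ : L2Formula P) {σ : Set (Set X)} {ν : P → Set X} {g g' : ℕ → X}
    {G G' : ℕ → Set X} (hg : ∀ x ∈ φ.freePt, g x = g' x) (hG : ∀ U ∈ φ.freeOpen, G U = G' U) :
    φ.Sat σ ν g G ↔ φ.Sat σ ν g' G' := by
  induction φ generalizing g g' G G' with
  | top => exact Iff.rfl
  | eqPt x y => simp only [Sat, hg x (Or.inl rfl), hg y (Or.inr rfl)]
  | eqOpen U V => simp only [Sat, hG U (Or.inl rfl), hG V (Or.inr rfl)]
  | pred p x => simp only [Sat, hg x rfl]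
  | mem x U => simp only [Sat, hg x rfl, hG U rfl]
  | neg φ ih => exact not_congr (ih hg hG)
  | and φ ψ h₁ h₂ =>
    exact and_congr (h₁ (fun x hx => hg x (Or.inl hx)) (fun U hU => hG U (Or.inl hU)))
      (h₂ (fun x hx => hg x (Or.inr hx)) (fun U hU => hG U (Or.inr hU)))
  | exPt x φ ih =>
    refine exists_congr fun a => ih (fun y hy => ?_) hG
    by_cases h : y = x
    · subst h; simp
    · simpa [h] using hg y ⟨hy, h⟩
  | exOpen U φ ih =>
    refine exists_congr fun O => and_congr_right fun _ => ih hg (fun V hV => ?_)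
    by_cases h : V = U
    · subst h; simp
    · simpa [h] using hG V ⟨hV, h⟩

/-- Truth is monotone in an open variable of positive polarity and antitone in one of negative
polarity. -/
theorem sat_of_hasPolarity (φ : L2Formula P) {σ : Set (Set X)} {ν : P → Set X} {U : ℕ} {b : Bool}
    (hφ : HasPolarity U b φ) {g : ℕ → X} {G G' : ℕ → Set X} (hne : ∀ V ≠ U, G V = G' V)
    (hU : bif b then G U ⊆ G' U else G' U ⊆ G U) (h : φ.Sat σ ν g G) : φ.Sat σ ν g G' := by
  induction φ generalizing b g G G' with
  | top => trivial
  | eqPt x y => exact h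
  | eqOpen V W => simpa only [Sat, hne V hφ.1, hne W hφ.2] using h
  | pred p x => exact h
  | mem x V =>
    by_cases hV : V = U
    · subst hV
      obtain rfl : b = true := hφ rfl
      exact hU h
    · simpa only [Sat, hne V hV] using h
  | neg φ ih =>
    refine fun h' => h (ih hφ (fun V hV => (hne V hV).symm) ?_ h')
    cases b <;> exact hU
  | and φ ψ h₁ h₂ => exact ⟨h₁ hφ.1 hne hU h.1, h₂ hφ.2 hne hU h.2⟩
  | exPt x φ ih =>
    obtain ⟨a, ha⟩ := h
    exact ⟨a, ih hφ hne hU ha⟩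
  | exOpen V φ ih =>
    obtain ⟨O, hO, h⟩ := h
    refine ⟨O, hO, ?_⟩
    by_cases hV : V = U
    · subst hV
      convert h using 1
      funext W
      by_cases hW : W = V
      · subst hW; simp
      · simp [hW, hne W hW]
    · refine ih (hφ.resolve_left hV) (fun W hW => ?_) ?_ h
      · by_cases hWV : W = V
        · subst hWV; simp
        · simp [hWV, hne W hW]
      · simpa [Function.update_of_ne (Ne.symm hV)] using hU

/-- Formulas of `L_t` do not distinguish a topology from a basis of it. -/
theorem IsLt.sat_basis_iff [TopologicalSpace X] {σ : Set (Set X)}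
    (hσ : TopologicalSpace.IsTopologicalBasis σ) {ν : P → Set X} {φ : L2Formula P} (hφ : φ.IsLt)
    (g : ℕ → X) (G : ℕ → Set X) :
    φ.Sat σ ν g G ↔ φ.Sat {O | IsOpen O} ν g G := by
  induction hφ generalizing g G with
  | top => exact Iff.rfl
  | eqPt x y => exact Iff.rfl
  | eqOpen U V => exact Iff.rfl
  | pred p x => exact Iff.rfl
  | mem x U => exact Iff.rfl
  | neg _ ih => exact not_congr (ih g G)
  | and _ _ h₁ h₂ => exact and_congr (h₁ g G) (h₂ g G)
  | exPt x _ ih => exact exists_congr fun a => ih _ G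
  | allOpen x U _ hpos ih =>
    simp only [L2Formula.allOpen, imp, Sat, ih, not_exists, not_and, not_not,
      Function.update_self]
    constructor
    · intro h O hO hx
      obtain ⟨B, hB, hxB, hBO⟩ := hσ.exists_subset_of_mem_open hx hO
      refine sat_of_hasPolarity _ hpos (fun V hV => ?_) ?_ (h B hB hxB)
      · simp [hV]
      · simpa using hBO
    · exact fun h O hO => h O (hσ.isOpen hO)
  | exOpen x U _ hneg ih =>
    simp only [Sat, ih, Function.update_self]
    constructor
    · rintro ⟨O, hO, h⟩
      exact ⟨O, hσ.isOpen hO, h⟩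
    · rintro ⟨O, hO, hx, h⟩
      obtain ⟨B, hB, hxB, hBO⟩ := hσ.exists_subset_of_mem_open hx hO
      refine ⟨B, hB, hxB, sat_of_hasPolarity _ hneg (fun V hV => ?_) ?_ h⟩
      · simp [hV]
      · simpa using hBO

end L2Formula

/-! ### Limit ultraproducts -/

namespace LimitUltraproduct

section

variable {J : Type u} {κ : Type v}

/-- A family of functions of a sequence of finite sets depends only on the terms of the sequence
with index less than `n`. -/
def DependsBelow {Z : J → Type w} (n : ℕ) (f : ∀ j, (ℕ → Finset κ) → Z j) : Prop :=
  ∀ j s t, (∀ k < n, s k = t k) → f j s = f j t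

theorem DependsBelow.mono {Z : J → Type w} {m n : ℕ} {f : ∀ j, (ℕ → Finset κ) → Z j}
    (hf : DependsBelow m f) (hmn : m ≤ n) : DependsBelow n f :=
  fun j s t h => hf j s t fun k hk => h k (hk.trans_le hmn)

/-- A fixed ultrafilter on the finite subsets of `κ` that contains the set of all finite sets with
the element `a`, for each `a`. -/
noncomputable def finsetUltrafilter (κ : Type v) : Ultrafilter (Finset κ) :=
  Ultrafilter.of Filter.atTop

theorem eventually_mem_finsetUltrafilter (a : κ) :
    ∀ᶠ i in (finsetUltrafilter κ).toFilter, a ∈ i := by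
  refine Ultrafilter.of_le Filter.atTop ?_
  filter_upwards [Filter.eventually_ge_atTop {a}] with i hi
  exact hi (Finset.mem_singleton_self a)

/-- The ultrafilter on `J × (ℕ → Finset κ)` that describes the `n`-fold iteration of the
ultrapower by `finsetUltrafilter κ`, applied to an ultraproduct by `𝒥`: the terms of the sequence
with index `n` or more are empty, and the term with the greatest index is the outermost one. -/
noncomputable def stage (𝒥 : Ultrafilter J) : ℕ → Ultrafilter (J × (ℕ → Finset κ))
  | 0 => 𝒥.map fun j => (j, fun _ => ∅)
  | n + 1 => (finsetUltrafilter κ).bind fun i =>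
      (stage 𝒥 n).map fun p => (p.1, Function.update p.2 n i)

theorem eventually_stage_zero (𝒥 : Ultrafilter J) {R : J × (ℕ → Finset κ) → Prop} :
    (∀ᶠ p in (stage 𝒥 0).toFilter, R p) ↔ ∀ᶠ j in 𝒥.toFilter, R (j, fun _ => ∅) :=
  Iff.rfl

theorem eventually_stage_succ (𝒥 : Ultrafilter J) (n : ℕ) {R : J × (ℕ → Finset κ) → Prop} :
    (∀ᶠ p in (stage 𝒥 (n + 1)).toFilter, R p) ↔
      ∀ᶠ i in (finsetUltrafilter κ).toFilter, ∀ᶠ p in (stage 𝒥 n).toFilter,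
        R (p.1, Function.update p.2 n i) :=
  Iff.rfl

/-- The ultrafilter of the limit ultraproduct. On sets of pairs `(j, s)` that depend on finitely
many terms of `s` it is the common value of almost all stages. -/
noncomputable def limit (κ : Type v) (𝒥 : Ultrafilter J) : Ultrafilter (J × (ℕ → Finset κ)) :=
  (Filter.hyperfilter ℕ).bind (stage 𝒥)

theorem eventually_limit_iff_stage (𝒥 : Ultrafilter J) {n : ℕ} {R : J → (ℕ → Finset κ) → Prop}
    (hR : DependsBelow n R) :
    (∀ᶠ p in (limit κ 𝒥).toFilter, R p.1 p.2) ↔ ∀ᶠ p in (stage 𝒥 n).toFilter, R p.1 p.2 := by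
  have hstage : ∀ m ≥ n, (∀ᶠ p in (stage 𝒥 m).toFilter, R p.1 p.2) ↔
      ∀ᶠ p in (stage 𝒥 n).toFilter, R p.1 p.2 := by
    intro m hm
    induction m, hm using Nat.le_induction with
    | base => exact Iff.rfl
    | succ m hm ih =>
      rw [eventually_stage_succ, ← ih]
      have hupd : ∀ (i : Finset κ) (p : J × (ℕ → Finset κ)),
          R p.1 (Function.update p.2 m i) = R p.1 p.2 := fun i p =>
        hR _ _ _ fun k hk => Function.update_of_ne (hk.trans_le hm).ne _ _
      simp only [hupd, Filter.eventually_const]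
  have hge : ∀ᶠ m in (Filter.hyperfilter ℕ).toFilter, m ≥ n :=
    Nat.hyperfilter_le_atTop (Filter.eventually_ge_atTop n)
  have h : (∀ᶠ p in (limit κ 𝒥).toFilter, R p.1 p.2) ↔
      ∀ᶠ m in (Filter.hyperfilter ℕ).toFilter, ∀ᶠ p in (stage 𝒥 m).toFilter, R p.1 p.2 := Iff.rfl
  rw [h, Filter.eventually_congr (hge.mono hstage), Filter.eventually_const]

theorem eventually_limit_fst (𝒥 : Ultrafilter J) {R : J → Prop} :
    (∀ᶠ p in (limit κ 𝒥).toFilter, R p.1) ↔ ∀ᶠ j in 𝒥.toFilter, R j := by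
  have h : DependsBelow 0 fun (j : J) (_ : ℕ → Finset κ) => R j := fun _ _ _ _ => rfl
  rw [eventually_limit_iff_stage 𝒥 h, eventually_stage_zero]

/-- Diagonalization: conditions that each hold almost everywhere and do not depend on the `n`-th
term of the sequence may be indexed by that term. -/
theorem eventually_limit_diagonal (𝒥 : Ultrafilter J) {n : ℕ}
    {R : Finset κ → J → (ℕ → Finset κ) → Prop} (hR : ∀ i, DependsBelow n (R i))
    (h : ∀ i, ∀ᶠ p in (limit κ 𝒥).toFilter, R i p.1 p.2) :
    ∀ᶠ p in (limit κ 𝒥).toFilter, R (p.2 n) p.1 p.2 := by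
  have hdep : DependsBelow (n + 1) fun j (s : ℕ → Finset κ) => R (s n) j s := by
    intro j s t hst
    simp only [hst n n.lt_succ_self]
    exact hR _ j s t fun k hk => hst k (hk.trans n.lt_succ_self)
  rw [eventually_limit_iff_stage 𝒥 hdep, eventually_stage_succ]
  refine Filter.Eventually.of_forall fun i => ?_
  filter_upwards [(eventually_limit_iff_stage 𝒥 (hR i)).1 (h i)] with p hp
  simp only [Function.update_self]
  rwa [hR i p.1 _ p.2 fun k hk => Function.update_of_ne hk.ne _ _]

theorem eventually_limit_mem (𝒥 : Ultrafilter J) (n : ℕ) (a : κ) :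
    ∀ᶠ p in (limit κ 𝒥).toFilter, a ∈ p.2 n := by
  have hdep : DependsBelow (n + 1) fun (_ : J) (s : ℕ → Finset κ) => a ∈ s n := by
    intro j s t hst
    simp only [hst n n.lt_succ_self]
  rw [eventually_limit_iff_stage 𝒥 hdep, eventually_stage_succ]
  simpa using eventually_mem_finsetUltrafilter a

/-- Saturation: a family of conditions indexed by `κ`, all depending on the first `n` terms of the
sequence, that is finitely satisfiable almost everywhere is satisfied by a function that depends
on the first `n + 1` terms. The function meets at `s` the conditions with index in `s n`. -/
theorem exists_forall_eventually_mem (𝒥 : Ultrafilter J) {Z : J → Type w} [∀ j, Nonempty (Z j)]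
    {n : ℕ} {C : κ → ∀ j, (ℕ → Finset κ) → Set (Z j)} (hC : ∀ a, DependsBelow n (C a))
    (h : ∀ i : Finset κ, ∀ᶠ p in (limit κ 𝒥).toFilter, ∃ z : Z p.1, ∀ a ∈ i, z ∈ C a p.1 p.2) :
    ∃ f : ∀ j, (ℕ → Finset κ) → Z j, DependsBelow (n + 1) f ∧
      ∀ a, ∀ᶠ p in (limit κ 𝒥).toFilter, f p.1 p.2 ∈ C a p.1 p.2 := by
  refine ⟨fun j s => Classical.epsilon fun z => ∀ a ∈ s n, z ∈ C a j s, ?_, fun a => ?_⟩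
  · intro j s t hst
    have hC' : ∀ a, C a j s = C a j t := fun a =>
      hC a j s t fun k hk => hst k (hk.trans n.lt_succ_self)
    simp only [hst n n.lt_succ_self, hC']
  · have hdiag := eventually_limit_diagonal 𝒥
      (R := fun i j s => ∃ z : Z j, ∀ a ∈ i, z ∈ C a j s) (n := n)
      (fun i j s t hst => by simp only [hC _ j s t hst]) h
    filter_upwards [hdiag, eventually_limit_mem 𝒥 n a] with p hp ha
    exact Classical.epsilon_spec hp a ha

end

section

variable {J : Type u} (Y : J → Type u) (κ : Type u) (𝒥 : Ultrafilter J)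

/-- Equality almost everywhere of families of functions that depend on finitely many terms. -/
def setoid : Setoid {f : ∀ j, (ℕ → Finset κ) → Y j // ∃ n, DependsBelow n f} where
  r f g := ∀ᶠ p in (limit κ 𝒥).toFilter, f.1 p.1 p.2 = g.1 p.1 p.2
  iseqv :=
    { refl := fun _ => Filter.Eventually.of_forall fun _ => rfl
      symm := fun h => h.mono fun _ => Eq.symm
      trans := fun h h' => (h.and h').mono fun _ hp => hp.1.trans hp.2 }

/-- The points of the limit ultraproduct of the family `Y`: the union of the chain of iterated
ultrapowers of the ultraproduct of `Y` by `𝒥`, represented by the functions that depend on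
finitely many terms of a sequence of finite sets. -/
def Point : Type u := Quotient (setoid Y κ 𝒥)

variable {Y κ}

/-- The point represented by a function that depends on finitely many terms. -/
def toPoint (f : ∀ j, (ℕ → Finset κ) → Y j) (hf : ∃ n, DependsBelow n f) : Point Y κ 𝒥 :=
  Quotient.mk (setoid Y κ 𝒥) ⟨f, hf⟩

/-- The internal set represented by a family of sets. -/
def internal (U : ∀ j, (ℕ → Finset κ) → Set (Y j)) : Set (Point Y κ 𝒥) :=
  {q | Quotient.liftOn q (fun f => ∀ᶠ p in (limit κ 𝒥).toFilter, f.1 p.1 p.2 ∈ U p.1 p.2)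
      fun f g hfg => by
    refine propext (Filter.eventually_congr (Filter.Eventually.mono hfg fun p hp => ?_))
    rw [hp]}

variable {𝒥}

theorem exists_toPoint (q : Point Y κ 𝒥) :
    ∃ n f, ∃ hf : DependsBelow n f, toPoint 𝒥 f ⟨n, hf⟩ = q := by
  obtain ⟨⟨f, n, hf⟩, rfl⟩ := Quotient.exists_rep q
  exact ⟨n, f, hf, rfl⟩

theorem toPoint_eq_toPoint {f g : ∀ j, (ℕ → Finset κ) → Y j} {hf : ∃ n, DependsBelow n f}
    {hg : ∃ n, DependsBelow n g} :
    toPoint 𝒥 f hf = toPoint 𝒥 g hg ↔ ∀ᶠ p in (limit κ 𝒥).toFilter, f p.1 p.2 = g p.1 p.2 :=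
  Quotient.eq (r := setoid Y κ 𝒥)

theorem toPoint_mem_internal {f : ∀ j, (ℕ → Finset κ) → Y j} {hf : ∃ n, DependsBelow n f}
    {U : ∀ j, (ℕ → Finset κ) → Set (Y j)} :
    toPoint 𝒥 f hf ∈ internal 𝒥 U ↔ ∀ᶠ p in (limit κ 𝒥).toFilter, f p.1 p.2 ∈ U p.1 p.2 :=
  Iff.rfl

instance [∀ j, Nonempty (Y j)] : Nonempty (Point Y κ 𝒥) :=
  ⟨toPoint 𝒥 (fun _ _ => Classical.arbitrary _) ⟨0, fun _ _ _ _ => rfl⟩⟩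

theorem internal_congr {U V : ∀ j, (ℕ → Finset κ) → Set (Y j)}
    (h : ∀ᶠ p in (limit κ 𝒥).toFilter, U p.1 p.2 = V p.1 p.2) : internal 𝒥 U = internal 𝒥 V := by
  ext q
  obtain ⟨n, f, hf, rfl⟩ := exists_toPoint q
  simp only [toPoint_mem_internal]
  refine Filter.eventually_congr (h.mono fun p hp => ?_)
  rw [hp]

theorem internal_eq_internal [∀ j, Nonempty (Y j)] {n : ℕ}
    {U V : ∀ j, (ℕ → Finset κ) → Set (Y j)} (hU : DependsBelow n U) (hV : DependsBelow n V) :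
    internal 𝒥 U = internal 𝒥 V ↔ ∀ᶠ p in (limit κ 𝒥).toFilter, U p.1 p.2 = V p.1 p.2 := by
  refine ⟨fun h => ?_, internal_congr⟩
  by_contra hne
  rw [← Ultrafilter.eventually_not] at hne
  -- A point at which the two sets differ almost everywhere.
  let f : ∀ j, (ℕ → Finset κ) → Y j := fun j s =>
    Classical.epsilon fun y => ¬(y ∈ U j s ↔ y ∈ V j s)
  have hf : DependsBelow n f := by
    intro j s t hst
    simp only [f, hU j s t hst, hV j s t hst]
  have hdiff : ∀ᶠ p in (limit κ 𝒥).toFilter, ¬(f p.1 p.2 ∈ U p.1 p.2 ↔ f p.1 p.2 ∈ V p.1 p.2) :=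
    hne.mono fun p hp => by
      refine Classical.epsilon_spec (p := fun y => ¬(y ∈ U p.1 p.2 ↔ y ∈ V p.1 p.2)) ?_
      by_contra! hall
      exact hp (Set.ext hall)
  have hiff := Set.ext_iff.1 h (toPoint 𝒥 f ⟨n, hf⟩)
  rw [toPoint_mem_internal, toPoint_mem_internal] at hiff
  have hsame : ∀ᶠ p in (limit κ 𝒥).toFilter, (f p.1 p.2 ∈ U p.1 p.2 ↔ f p.1 p.2 ∈ V p.1 p.2) := by
    simp only [iff_iff_implies_and_implies, Filter.eventually_and, Ultrafilter.eventually_imp]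
    exact ⟨hiff.1, hiff.2⟩
  obtain ⟨p, hp, hp'⟩ := (hdiff.and hsame).exists
  exact hp hp'

section Topology

variable [∀ j, TopologicalSpace (Y j)]

variable (Y κ 𝒥) in
/-- The internal open sets: those represented by families that depend on finitely many terms and
are open almost everywhere. -/
def internalOpens : Set (Set (Point Y κ 𝒥)) :=
  {S | ∃ n, ∃ U : ∀ j, (ℕ → Finset κ) → Set (Y j), DependsBelow n U ∧
    (∀ᶠ p in (limit κ 𝒥).toFilter, IsOpen (U p.1 p.2)) ∧ S = internal 𝒥 U}

instance : TopologicalSpace (Point Y κ 𝒥) :=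
  TopologicalSpace.generateFrom (internalOpens Y κ 𝒥)

theorem isTopologicalBasis_internalOpens :
    TopologicalSpace.IsTopologicalBasis (internalOpens Y κ 𝒥) := by
  refine ⟨?_, ?_, rfl⟩
  · rintro _ ⟨n, U, hU, hUo, rfl⟩ _ ⟨m, V, hV, hVo, rfl⟩ q hq
    obtain ⟨k, f, hf, rfl⟩ := exists_toPoint q
    refine ⟨internal 𝒥 fun j s => U j s ∩ V j s, ⟨max n m, _, ?_, ?_, rfl⟩, ?_, ?_⟩
    · intro j s t hst
      simp only [hU.mono (le_max_left n m) j s t hst, hV.mono (le_max_right n m) j s t hst]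
    · filter_upwards [hUo, hVo] with p hp hp' using hp.inter hp'
    · exact toPoint_mem_internal.2 ((toPoint_mem_internal.1 hq.1).and (toPoint_mem_internal.1 hq.2))
    · intro r hr
      obtain ⟨l, h, hh, rfl⟩ := exists_toPoint r
      have hr' := toPoint_mem_internal.1 hr
      exact ⟨toPoint_mem_internal.2 (hr'.mono fun p hp => hp.1),
        toPoint_mem_internal.2 (hr'.mono fun p hp => hp.2)⟩
  · refine Set.eq_univ_of_forall fun q => ⟨internal 𝒥 fun _ _ => Set.univ,
      ⟨0, _, fun _ _ _ _ => rfl, Filter.Eventually.of_forall fun _ => isOpen_univ, rfl⟩, ?_⟩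
    obtain ⟨k, f, hf, rfl⟩ := exists_toPoint q
    exact toPoint_mem_internal.2 (Filter.Eventually.of_forall fun _ => trivial)

/-- Łoś's theorem for `L²`, with the open variables ranging over the internal open sets. All terms
of the assignments are to depend on a common number `n` of terms of the sequence. -/
theorem sat_iff [∀ j, Nonempty (Y j)] {P : Type v} (ν : P → ∀ j, Set (Y j)) (φ : L2Formula P)
    {n : ℕ} {g : ℕ → ∀ j, (ℕ → Finset κ) → Y j} (hg : ∀ x, DependsBelow n (g x))
    {G : ℕ → ∀ j, (ℕ → Finset κ) → Set (Y j)} (hG : ∀ U, DependsBelow n (G U)) :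
    φ.Sat (internalOpens Y κ 𝒥) (fun p => internal 𝒥 fun j _ => ν p j)
        (fun x => toPoint 𝒥 (g x) ⟨n, hg x⟩) (fun U => internal 𝒥 (G U)) ↔
      ∀ᶠ p in (limit κ 𝒥).toFilter, φ.Sat {O : Set (Y p.1) | IsOpen O} (fun q => ν q p.1)
        (fun x => g x p.1 p.2) (fun U => G U p.1 p.2) := by
  induction φ generalizing n g G with
  | top => simp [L2Formula.Sat]
  | eqPt x y => exact toPoint_eq_toPoint
  | eqOpen U V => exact internal_eq_internal (hG U) (hG V)
  | pred p x => exact toPoint_mem_internal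
  | mem x U => exact toPoint_mem_internal
  | neg φ ih => exact (not_congr (ih hg hG)).trans Ultrafilter.eventually_not.symm
  | and φ ψ h₁ h₂ => exact (and_congr (h₁ hg hG) (h₂ hg hG)).trans Filter.eventually_and.symm
  | exPt x φ ih =>
    have key : ∀ (m : ℕ) (hm : n ≤ m) (a : ∀ j, (ℕ → Finset κ) → Y j) (ha : DependsBelow m a),
        φ.Sat (internalOpens Y κ 𝒥) (fun p => internal 𝒥 fun j _ => ν p j)
            (Function.update (fun x => toPoint 𝒥 (g x) ⟨n, hg x⟩) x (toPoint 𝒥 a ⟨m, ha⟩))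
            (fun U => internal 𝒥 (G U)) ↔
          ∀ᶠ p in (limit κ 𝒥).toFilter, φ.Sat {O : Set (Y p.1) | IsOpen O} (fun q => ν q p.1)
            (Function.update (fun x => g x p.1 p.2) x (a p.1 p.2)) (fun U => G U p.1 p.2) := by
      intro m hm a ha
      have hg' : ∀ y, DependsBelow m (Function.update g x a y) := by
        intro y
        by_cases hy : y = x
        · subst hy; rwa [Function.update_self]
        · rw [Function.update_of_ne hy]; exact (hg y).mono hm
      convert ih hg' (fun U => (hG U).mono hm) using 1
      · refine iff_of_eq (congrArg (fun g' => φ.Sat _ _ g' _) (funext fun y => ?_))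
        by_cases hy : y = x
        · subst hy; simp only [Function.update_self]
        · simp only [Function.update_of_ne hy]
      · refine Filter.eventually_congr (Filter.Eventually.of_forall fun p => ?_)
        exact iff_of_eq (congrArg (fun g' => φ.Sat _ _ g' _)
          (Function.comp_update (fun f : ∀ j, (ℕ → Finset κ) → Y j => f p.1 p.2) g x a).symm)
    constructor
    · rintro ⟨q, hq⟩
      obtain ⟨m, a, ha, rfl⟩ := exists_toPoint q
      have ha' := ha.mono (le_max_right n m)
      exact ((key (max n m) (le_max_left n m) a ha').1 hq).mono fun p hp => ⟨_, hp⟩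
    · intro h
      let a : ∀ j, (ℕ → Finset κ) → Y j := fun j s => Classical.epsilon fun b =>
        φ.Sat {O : Set (Y j) | IsOpen O} (fun q => ν q j)
          (Function.update (fun x => g x j s) x b) (fun U => G U j s)
      have ha : DependsBelow n a := by
        intro j s t hst
        simp only [a, hg _ j s t hst, hG _ j s t hst]
      exact ⟨toPoint 𝒥 a ⟨n, ha⟩, (key n le_rfl a ha).2
        (h.mono fun p hp => Classical.epsilon_spec hp)⟩
  | exOpen U φ ih =>
    have key : ∀ (m : ℕ) (hm : n ≤ m) (O : ∀ j, (ℕ → Finset κ) → Set (Y j))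
        (hO : DependsBelow m O),
        φ.Sat (internalOpens Y κ 𝒥) (fun p => internal 𝒥 fun j _ => ν p j)
            (fun x => toPoint 𝒥 (g x) ⟨n, hg x⟩)
            (Function.update (fun U => internal 𝒥 (G U)) U (internal 𝒥 O)) ↔
          ∀ᶠ p in (limit κ 𝒥).toFilter, φ.Sat {O : Set (Y p.1) | IsOpen O} (fun q => ν q p.1)
            (fun x => g x p.1 p.2) (Function.update (fun U => G U p.1 p.2) U (O p.1 p.2)) := by
      intro m hm O hO
      have hG' : ∀ V, DependsBelow m (Function.update G U O V) := by
        intro V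
        by_cases hV : V = U
        · subst hV; rwa [Function.update_self]
        · rw [Function.update_of_ne hV]; exact (hG V).mono hm
      convert ih (fun x => (hg x).mono hm) hG' using 1
      · refine iff_of_eq (congrArg (φ.Sat _ _ _) (funext fun V => ?_))
        by_cases hV : V = U
        · subst hV; simp only [Function.update_self]
        · simp only [Function.update_of_ne hV]
      · refine Filter.eventually_congr (Filter.Eventually.of_forall fun p => ?_)
        exact iff_of_eq (congrArg (φ.Sat _ _ _)
          (Function.comp_update (fun W : ∀ j, (ℕ → Finset κ) → Set (Y j) => W p.1 p.2) G U O).symm)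
    constructor
    · rintro ⟨_, ⟨m, O, hO, hopen, rfl⟩, h⟩
      have hO' := hO.mono (le_max_right n m)
      filter_upwards [(key (max n m) (le_max_left n m) O hO').1 h, hopen] with p hp hp'
      exact ⟨_, hp', hp⟩
    · intro h
      let O : ∀ j, (ℕ → Finset κ) → Set (Y j) := fun j s => Classical.epsilon fun B =>
        B ∈ {O : Set (Y j) | IsOpen O} ∧ φ.Sat {O : Set (Y j) | IsOpen O} (fun q => ν q j)
          (fun x => g x j s) (Function.update (fun U => G U j s) U B)
      have hO : DependsBelow n O := by
        intro j s t hst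
        simp only [O, hg _ j s t hst, hG _ j s t hst]
      have hspec : ∀ᶠ p in (limit κ 𝒥).toFilter, O p.1 p.2 ∈ {O : Set (Y p.1) | IsOpen O} ∧
          φ.Sat {O : Set (Y p.1) | IsOpen O} (fun q => ν q p.1) (fun x => g x p.1 p.2)
            (Function.update (fun U => G U p.1 p.2) U (O p.1 p.2)) :=
        h.mono fun p hp => Classical.epsilon_spec hp
      exact ⟨_, ⟨n, O, hO, hspec.mono fun p hp => hp.1, rfl⟩,
        (key n le_rfl O hO).2 (hspec.mono fun p hp => hp.2)⟩

/-- An `L_t`-sentence that is true in all members of a family of spaces is true in their limit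
ultraproduct. -/
theorem holdsIn_point [∀ j, Nonempty (Y j)] {φ : L2Formula Empty} (hφ : φ.IsLt)
    (hs : φ.IsSentence) (h : ∀ j, φ.HoldsIn (Y j)) : φ.HoldsIn (Point Y κ 𝒥) := by
  intro g G _
  rw [← hφ.sat_basis_iff isTopologicalBasis_internalOpens]
  have hlos := (sat_iff (𝒥 := 𝒥) (κ := κ) (fun (p : Empty) (_ : J) => p.elim) φ (n := 0)
    (g := fun _ j _ => Classical.arbitrary (Y j)) (fun _ _ _ _ _ => rfl)
    (G := fun _ _ _ => Set.univ) (fun _ _ _ _ _ => rfl)).2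
    (Filter.Eventually.of_forall fun p => by
      convert h p.1 (fun _ => Classical.arbitrary (Y p.1)) (fun _ => Set.univ)
        (fun _ => isOpen_univ) using 1)
  rw [L2Formula.sat_congr φ (g' := g) (G' := G) (by simp [hs.1]) (by simp [hs.2])] at hlos
  convert hlos using 1

end Topology

end

end LimitUltraproduct

/-! ### The interior map onto the Alexandroff extension -/

/-- A family of maps from the powerset of `X` to the powersets of the spaces `Y j` represents
`X` along `𝒥` if every instance of the laws of a homomorphism of interior algebras, and of
preservation of nonemptiness, holds in `𝒥`-almost all of the spaces. -/
structure RepresentsAlong {X : Type u} [TopologicalSpace X] {J : Type v} (𝒥 : Ultrafilter J)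
    {Y : J → Type w} [∀ j, TopologicalSpace (Y j)] (ν : Set X → ∀ j, Set (Y j)) : Prop where
  map_compl : ∀ A, ∀ᶠ j in 𝒥.toFilter, ν Aᶜ j = (ν A j)ᶜ
  map_inter : ∀ A B, ∀ᶠ j in 𝒥.toFilter, ν (A ∩ B) j = ν A j ∩ ν B j
  map_interior : ∀ A, ∀ᶠ j in 𝒥.toFilter, ν (interior A) j = interior (ν A j)
  map_nonempty : ∀ A, A.Nonempty → ∀ᶠ j in 𝒥.toFilter, (ν A j).Nonempty

namespace RepresentsAlong

section

variable {X : Type u} [TopologicalSpace X] {J : Type v} {𝒥 : Ultrafilter J}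
  {Y : J → Type w} [∀ j, TopologicalSpace (Y j)] {ν : Set X → ∀ j, Set (Y j)}

theorem univ (h : RepresentsAlong 𝒥 ν) : ∀ᶠ j in 𝒥.toFilter, ν Set.univ j = Set.univ := by
  filter_upwards [h.map_compl ∅, h.map_inter ∅ Set.univ] with j h1 h2
  rw [Set.compl_empty] at h1
  rw [Set.empty_inter, h1] at h2
  rw [h1, h2, Set.inter_compl_self, Set.compl_empty]

theorem mono (h : RepresentsAlong 𝒥 ν) {A B : Set X} (hAB : A ⊆ B) :
    ∀ᶠ j in 𝒥.toFilter, ν A j ⊆ ν B j := by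
  filter_upwards [h.map_inter A B] with j hj
  rw [Set.inter_eq_left.2 hAB] at hj
  rw [hj]
  exact Set.inter_subset_right

theorem isOpen (h : RepresentsAlong 𝒥 ν) {A : Set X} (hA : IsOpen A) :
    ∀ᶠ j in 𝒥.toFilter, IsOpen (ν A j) := by
  filter_upwards [h.map_interior A] with j hj
  rw [hA.interior_eq] at hj
  rw [hj]
  exact isOpen_interior

end

open LimitUltraproduct

variable {X : Type u} [TopologicalSpace X] {J : Type u} {𝒥 : Ultrafilter J}
  {Y : J → Type u} [∀ j, TopologicalSpace (Y j)] {ν : Set X → ∀ j, Set (Y j)}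

/-- The ultrafilter of those subsets of `X` whose representatives contain a given point of the
limit ultraproduct. -/
def toExtension (h : RepresentsAlong 𝒥 ν) (q : Point Y (Set X) 𝒥) : AlexandroffExtension X :=
  Ultrafilter.ofComplNotMemIff
    { sets := {A | q ∈ internal 𝒥 fun j _ => ν A j}
      univ_sets := by
        obtain ⟨n, f, hf, rfl⟩ := exists_toPoint q
        change toPoint 𝒥 f ⟨n, hf⟩ ∈ internal 𝒥 fun j _ => ν Set.univ j
        refine toPoint_mem_internal.2 (((eventually_limit_fst 𝒥).2 h.univ).mono fun p hp => ?_)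
        rw [hp]
        trivial
      sets_of_superset := fun {A B} hA hAB => by
        obtain ⟨n, f, hf, rfl⟩ := exists_toPoint q
        change toPoint 𝒥 f ⟨n, hf⟩ ∈ internal 𝒥 fun j _ => ν A j at hA
        change toPoint 𝒥 f ⟨n, hf⟩ ∈ internal 𝒥 fun j _ => ν B j
        refine toPoint_mem_internal.2 ?_
        filter_upwards [toPoint_mem_internal.1 hA, (eventually_limit_fst 𝒥).2 (h.mono hAB)]
          with p hp hp' using hp' hp
      inter_sets := fun {A B} hA hB => by
        obtain ⟨n, f, hf, rfl⟩ := exists_toPoint q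
        change toPoint 𝒥 f ⟨n, hf⟩ ∈ internal 𝒥 fun j _ => ν A j at hA
        change toPoint 𝒥 f ⟨n, hf⟩ ∈ internal 𝒥 fun j _ => ν B j at hB
        change toPoint 𝒥 f ⟨n, hf⟩ ∈ internal 𝒥 fun j _ => ν (A ∩ B) j
        refine toPoint_mem_internal.2 ?_
        filter_upwards [toPoint_mem_internal.1 hA, toPoint_mem_internal.1 hB,
          (eventually_limit_fst 𝒥).2 (h.map_inter A B)] with p hp hp' hp''
        rw [hp'']
        exact ⟨hp, hp'⟩ }
    (fun A => by
      obtain ⟨n, f, hf, rfl⟩ := exists_toPoint q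
      have hcompl : (toPoint 𝒥 f ⟨n, hf⟩ ∈ internal 𝒥 fun j _ => ν Aᶜ j) ↔
          toPoint 𝒥 f ⟨n, hf⟩ ∉ internal 𝒥 fun j _ => ν A j := by
        rw [toPoint_mem_internal, toPoint_mem_internal, ← Ultrafilter.eventually_not]
        refine Filter.eventually_congr
          (((eventually_limit_fst 𝒥).2 (h.map_compl A)).mono fun p hp => ?_)
        rw [hp, Set.mem_compl_iff]
      exact (not_congr hcompl).trans not_not)

theorem mem_toExtension_toPoint (h : RepresentsAlong 𝒥 ν) {f : ∀ j, (ℕ → Finset (Set X)) → Y j}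
    {hf : ∃ n, DependsBelow n f} {A : Set X} :
    A ∈ (show Ultrafilter X from h.toExtension (toPoint 𝒥 f hf)) ↔
      ∀ᶠ p in (limit (Set X) 𝒥).toFilter, f p.1 p.2 ∈ ν A p.1 :=
  Iff.rfl

/-- Finitely many members of an ultrafilter have a common lower bound in it, their intersection,
whose representative is almost everywhere contained in theirs. -/
theorem exists_mem_subset (h : RepresentsAlong 𝒥 ν) (𝔳 : Ultrafilter X) (i : Finset (Set X)) :
    ∃ B ∈ 𝔳, ∀ᶠ j in 𝒥.toFilter, ∀ A ∈ i, A ∈ 𝔳 → ν B j ⊆ ν A j := by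
  refine ⟨⋂₀ {A | A ∈ i ∧ A ∈ 𝔳}, ?_, ?_⟩
  · exact (Filter.sInter_mem (i.finite_toSet.subset fun A hA => hA.1)).2 fun A hA => hA.2
  · rw [Filter.eventually_all_finset]
    intro A hA
    by_cases hA' : A ∈ 𝔳
    · have hsub := Set.sInter_subset_of_mem (show A ∈ {A | A ∈ i ∧ A ∈ 𝔳} from ⟨hA, hA'⟩)
      exact (h.mono hsub).mono fun j hj _ => hj
    · exact Filter.Eventually.of_forall fun j hj => absurd hj hA'

theorem surjective_toExtension [∀ j, Nonempty (Y j)] (h : RepresentsAlong 𝒥 ν) :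
    Function.Surjective h.toExtension := by
  intro 𝔳
  change Ultrafilter X at 𝔳
  obtain ⟨f, hf, hfC⟩ := exists_forall_eventually_mem 𝒥 (n := 0)
    (C := fun A j (_ : ℕ → Finset (Set X)) => {y : Y j | A ∈ 𝔳 → y ∈ ν A j})
    (fun _ _ _ _ _ => rfl) (fun i => by
      obtain ⟨B, hB, hBi⟩ := h.exists_mem_subset 𝔳 i
      refine (eventually_limit_fst 𝒥
        (R := fun j => ∃ y : Y j, ∀ A ∈ i, A ∈ 𝔳 → y ∈ ν A j)).2 ?_
      filter_upwards [hBi, h.map_nonempty B (Ultrafilter.nonempty_of_mem hB)] with j hj ⟨y, hy⟩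
      exact ⟨y, fun A hA hA' => hj A hA hA' hy⟩)
  refine ⟨toPoint 𝒥 f ⟨1, hf⟩, ?_⟩
  refine (Ultrafilter.coe_le_coe (f := h.toExtension (toPoint 𝒥 f ⟨1, hf⟩)) (g := 𝔳)).1
    fun A hA => ?_
  exact (h.mem_toExtension_toPoint).2 ((hfC A).mono fun p hp => hp hA)

theorem continuous_toExtension (h : RepresentsAlong 𝒥 ν) : Continuous h.toExtension := by
  refine continuous_generateFrom_iff.2 ?_
  rintro _ ⟨F, hF, rfl⟩
  rw [isTopologicalBasis_internalOpens.isOpen_iff]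
  intro q hq
  obtain ⟨n, f, hf, rfl⟩ := exists_toPoint q
  -- A neighbourhood of the point inside the representatives of all open members of its image.
  -- The first two clauses do not depend on `A`; they are read off at `∅` afterwards.
  obtain ⟨U, hU, hUC⟩ := exists_forall_eventually_mem 𝒥 (n := n) (Z := fun j => Set (Y j))
    (C := fun A j s => {O | IsOpen O ∧ f j s ∈ O ∧
      (IsOpen A → A ∈ (show Ultrafilter X from h.toExtension (toPoint 𝒥 f ⟨n, hf⟩)) → O ⊆ ν A j)})
    (fun A j s t hst => by simp only [hf j s t hst]) (fun i => by
      have hall : ∀ᶠ p in (limit (Set X) 𝒥).toFilter, ∀ A ∈ i,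
          IsOpen A ∧ A ∈ (show Ultrafilter X from h.toExtension (toPoint 𝒥 f ⟨n, hf⟩)) →
            IsOpen (ν A p.1) ∧ f p.1 p.2 ∈ ν A p.1 := by
        rw [Filter.eventually_all_finset]
        intro A _
        by_cases hA : IsOpen A ∧ A ∈ (show Ultrafilter X from h.toExtension (toPoint 𝒥 f ⟨n, hf⟩))
        · filter_upwards [(eventually_limit_fst 𝒥).2 (h.isOpen hA.1),
            h.mem_toExtension_toPoint.1 hA.2] with p hp hp' _ using ⟨hp, hp'⟩
        · exact Filter.Eventually.of_forall fun p hp => absurd hp hA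
      refine hall.mono fun p hp => ?_
      let 𝒜 : Set (Set X) := {A | A ∈ i ∧ IsOpen A ∧
        A ∈ (show Ultrafilter X from h.toExtension (toPoint 𝒥 f ⟨n, hf⟩))}
      have hfin : 𝒜.Finite := i.finite_toSet.subset fun A hA => hA.1
      refine ⟨⋂ A ∈ 𝒜, ν A p.1, fun A hA => ⟨?_, ?_, ?_⟩⟩
      · exact hfin.isOpen_biInter fun A hA => (hp A hA.1 hA.2).1
      · exact Set.mem_iInter₂.2 fun A hA => (hp A hA.1 hA.2).2
      · exact fun hA1 hA2 => Set.biInter_subset_of_mem (show A ∈ 𝒜 from ⟨hA, hA1, hA2⟩))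
  refine ⟨internal 𝒥 U, ⟨n + 1, U, hU, (hUC ∅).mono fun p hp => hp.1, rfl⟩,
    toPoint_mem_internal.2 ((hUC ∅).mono fun p hp => hp.2.1), fun r hr A hA => ?_⟩
  obtain ⟨m, g, hg, rfl⟩ := exists_toPoint r
  refine Filter.mem_of_superset (x := interior A) ?_ interior_subset
  refine h.mem_toExtension_toPoint.2 ?_
  filter_upwards [toPoint_mem_internal.1 hr, hUC (interior A)] with p hp hp'
  exact hp'.2.2 isOpen_interior (hq _ (hF A hA)) hp

theorem isOpenMap_toExtension [∀ j, Nonempty (Y j)] (h : RepresentsAlong 𝒥 ν) :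
    IsOpenMap h.toExtension := by
  refine isTopologicalBasis_internalOpens.isOpenMap_iff.2 ?_
  rintro _ ⟨m, U, hU, hUo, rfl⟩
  refine isOpen_iff_forall_mem_open.2 ?_
  rintro _ ⟨q, hq, rfl⟩
  obtain ⟨n, f, hf, rfl⟩ := exists_toPoint q
  refine ⟨AlexandroffExtension.minNhd (h.toExtension (toPoint 𝒥 f ⟨n, hf⟩)), ?_,
    AlexandroffExtension.isOpen_minNhd _, AlexandroffExtension.self_mem_minNhd _⟩
  intro 𝔳 h𝔳
  change Ultrafilter X at 𝔳
  obtain ⟨g, hg, hgC⟩ := exists_forall_eventually_mem 𝒥 (n := m)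
    (C := fun A j s => {y : Y j | y ∈ U j s ∧ (A ∈ 𝔳 → y ∈ ν A j)})
    (fun A j s t hst => by simp only [hU j s t hst]) (fun i => by
      obtain ⟨B, hB, hBi⟩ := h.exists_mem_subset 𝔳 i
      -- The point represented by `f` is in the closure of `B`, as `𝔳` is in its smallest
      -- neighbourhood.
      have hcl : interior Bᶜ ∉
          (show Ultrafilter X from h.toExtension (toPoint 𝒥 f ⟨n, hf⟩)) := fun hint =>
        Ultrafilter.compl_mem_iff_notMem.1 (h𝔳 Bᶜ hint) hB
      rw [h.mem_toExtension_toPoint, ← Ultrafilter.eventually_not] at hcl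
      filter_upwards [hcl, hUo, toPoint_mem_internal.1 hq, (eventually_limit_fst 𝒥).2 hBi,
        (eventually_limit_fst 𝒥).2 (h.map_interior Bᶜ), (eventually_limit_fst 𝒥).2 (h.map_compl B)]
        with p hp1 hp2 hp3 hp4 hp5 hp6
      rw [hp5, hp6, interior_compl, Set.notMem_compl_iff] at hp1
      obtain ⟨y, hyU, hyB⟩ := mem_closure_iff.1 hp1 _ hp2 hp3
      exact ⟨y, fun A hA => ⟨hyU, fun hA' => hp4 A hA hA' hyB⟩⟩)
  refine ⟨toPoint 𝒥 g ⟨m + 1, hg⟩, toPoint_mem_internal.2 ((hgC ∅).mono fun p hp => hp.1), ?_⟩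
  refine (Ultrafilter.coe_le_coe (f := h.toExtension (toPoint 𝒥 g ⟨m + 1, hg⟩)) (g := 𝔳)).1
    fun A hA => ?_
  exact (h.mem_toExtension_toPoint).2 ((hgC A).mono fun p hp => hp.2 hA)

end RepresentsAlong

/-! ### Definability -/

/-- The formulas that are true at all points of `X` when the letters are the subsets of `X`, each
interpreted by itself. -/
abbrev GlobalTheory (X : Type u) [TopologicalSpace X] : Type u :=
  {φ : MEFormula (Set X) // ∀ x, φ.Sat id x}

open MEFormula in
/-- Models on the spaces `Y j` in which the formulas of `j` are globally true, for each finite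
`j ⊆ GlobalTheory X`, represent `X` along every ultrafilter finer than `atTop`. -/
theorem representsAlong_of_sat {X : Type u} [TopologicalSpace X]
    {𝒥 : Ultrafilter (Finset (GlobalTheory X))}
    (h𝒥 : 𝒥.toFilter ≤ Filter.atTop)
    {Y : Finset (GlobalTheory X) → Type u}
    [∀ j, TopologicalSpace (Y j)] [∀ j, Nonempty (Y j)] {ν : ∀ j, Set X → Set (Y j)}
    (hν : ∀ (j : Finset (GlobalTheory X)), ∀ φ ∈ j, ∀ y, φ.1.Sat (ν j) y) :
    RepresentsAlong 𝒥 fun A j => ν j A := by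
  have key : ∀ φ : MEFormula (Set X), (∀ x, φ.Sat id x) →
      ∀ᶠ j in 𝒥.toFilter, ∀ y, φ.Sat (ν j) y := fun φ hφ => by
    filter_upwards [h𝒥 (Filter.eventually_ge_atTop {⟨φ, hφ⟩})] with j hj
    exact hν j ⟨φ, hφ⟩ (hj (Finset.mem_singleton_self _))
  -- The biconditional of `φ` and `ψ`.
  let biimp : MEFormula (Set X) → MEFormula (Set X) → MEFormula (Set X) := fun φ ψ =>
    and (neg (and φ (neg ψ))) (neg (and ψ (neg φ)))
  have sat_iff : ∀ {Z : Type u} [TopologicalSpace Z] (μ : Set X → Set Z)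
      (φ ψ : MEFormula (Set X)), (∀ z, (biimp φ ψ).Sat μ z) ↔ {z | φ.Sat μ z} = {z | ψ.Sat μ z} := by
    intro Z _ μ φ ψ
    simp only [biimp, Sat, Set.ext_iff, Set.mem_ofPred_eq]
    exact forall_congr' fun z => by tauto
  have key' : ∀ φ ψ : MEFormula (Set X), {x | φ.Sat id x} = {x | ψ.Sat id x} →
      ∀ᶠ j in 𝒥.toFilter, {y | φ.Sat (ν j) y} = {y | ψ.Sat (ν j) y} := fun φ ψ h => by
    filter_upwards [key _ ((sat_iff id φ ψ).2 h)] with j hj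
    exact (sat_iff (ν j) φ ψ).1 hj
  refine ⟨fun A => key' (letter Aᶜ) (neg (letter A)) rfl,
    fun A B => key' (letter (A ∩ B)) (and (letter A) (letter B)) rfl,
    fun A => ?_, fun A hA => ?_⟩
  · filter_upwards [key' (letter (interior A)) (box (letter A)) (setOf_sat_box id (letter A)).symm]
      with j hj
    exact hj.trans (setOf_sat_box (ν j) (letter A))
  · filter_upwards [key (glob (letter A)) fun _ => hA] with j hj
    exact hj (Classical.arbitrary _)

theorem theorem5p1 (K : SpaceClass.{u}) (hK : LtDefinable K) :
    GlobalModalDefinable K ↔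
      ClosedUnderInteriorImages K ∧ ReflectsAlexandroffExtensions K := by
  constructor
  · rintro ⟨Γ, hΓ⟩
    exact ⟨fun X Y _ _ _ _ f hc ho hs hX => (hΓ Y).2 fun φ hφ =>
        ((hΓ X).1 hX φ hφ).of_interior_image hc ho hs,
      fun X _ _ hX => (hΓ X).2 fun φ hφ =>
        AlexandroffExtension.valid_of_valid ((hΓ _).1 hX φ hφ)⟩
  · rintro ⟨himage, hreflect⟩
    obtain ⟨T, hT, hKT⟩ := hK
    refine ⟨{φ | ∀ (Y : Type u) [TopologicalSpace Y] [Nonempty Y], K Y → φ.Valid Y},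
      fun X _ _ => ⟨fun hX φ hφ => hφ X hX, fun hX => hreflect X ?_⟩⟩
    have hmodel : ∀ j : Finset (GlobalTheory X),
        ∃ (Y : Type u) (_ : TopologicalSpace Y) (_ : Nonempty Y) (ν : Set X → Set Y),
          K Y ∧ ∀ φ ∈ j, ∀ y, φ.1.Sat ν y := fun j => by
      obtain ⟨Y, hY₁, hY₂, ν, hKY, hν⟩ := MEFormula.exists_model hX id
        (j.map (Function.Embedding.subtype _)) (fun φ hφ => by
          obtain ⟨ψ, _, rfl⟩ := Finset.mem_map.1 hφ
          exact ψ.2)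
      exact ⟨Y, hY₁, hY₂, ν, hKY, fun φ hφ => hν φ.1 (Finset.mem_map_of_mem _ hφ)⟩
    choose Y tY nY ν hKY hν using hmodel
    have hrep := representsAlong_of_sat (Ultrafilter.of_le Filter.atTop) hν
    refine himage _ _ hrep.toExtension hrep.continuous_toExtension hrep.isOpenMap_toExtension
      hrep.surjective_toExtension ((hKT _).2 fun φ hφ => ?_)
    exact LimitUltraproduct.holdsIn_point (hT φ hφ).1 (hT φ hφ).2 fun j => (hKT _).1 (hKY j) φ hφ
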